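/- Let $A$ be a finite alphabet, $X=A^{\mathbb Z^2}$ with the product topology and product $\sigma$-algebra, and let $\sigma_1(x)_{(i,j)}=x_{(i+1,j)}$, $\sigma_2(x)_{(i,j)}=x_{(i,j+1)}$. Let $F:X\to X$ be a two-dimensional cellular automaton, i.e. a continuous map commuting with $\sigma_1$ and $\sigma_2$, and let $\mu$ be a probability measure on $X$ that is invariant under $\sigma_1$, $\sigma_2$ and $F$ (no ergodicity is needed). *Entropies.* For a finite measurable partition $\alpha$ put $H_\mu(\alpha)=-\sum_{C\in\alpha}\mu(C)\log\mu(C)$, $$h_\mu(F,\alpha)=\lim_{n\to\infty}\frac1n H_\mu\Big(\bigvee_{k=0}^{n-1}F^{-k}\alpha\Big),\qquad h_\mu(\sigma_1,\sigma_2)=\sup_\alpha\lim_{n\to\infty}\frac1{n^2}H_\mu\Big(\bigvee_{0\le i,j<n}\sigma_1^{-i}\sigma_2^{-j}\alpha\Big),$$ the supremum being over all finite measurable partitions. Let $\alpha_n$ be the partition of $X$ according to the coordinates in $\{0,\dots,n-1\}^2$, and define $$h^{2D}_\mu(F)=\liminf_{n\to\infty}\frac1n h_\mu(F,\alpha_n).$$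 *Directional Lyapunov exponents.* For $\theta\in\mathbb R$ and $p\in\mathbb Z^2$ let $W^\theta_p\subset\mathbb Z^2$ consist of all $q\in\mathbb Z^2$ with $\langle q-p,(\cos\theta,\sin\theta)\rangle\le 0$ together with the coordinatewise integer parts of the points of the real line through $p$ orthogonal to $(\cos\theta,\sin\theta)$. For $x\in X$ let $W^\theta_p(x)$ be the set of $y\in X$ that agree with $x$ on $W^\theta_p$. Put $$\Lambda_n^F(\theta)(x)=\min\big\{\|p\|_2 : p\in\mathbb Z^2,\ (0,0)\in W^\theta_p,\ F^k(W^\theta_p(x))\subset W^\theta_{(0,0)}(F^k(x))\text{ for all }1\le k\le n\big\},$$ $\Lambda_n^F(\theta)=\max_{x\in X}\Lambda_n^F(\theta)(x)$ and $\lambda(\theta)=\lim_{n\to\infty}\Lambda_n^F(\theta)/n$. Then the limits $\lambda(0),\lambda(\pi/2),\lambda(\pi),\lambda(3\pi/2)$ exist, and $$h^{2D}_\mu(F)\le h_\mu(\sigma_1,\sigma_2)\,\big(\lambda(0)+\lambda(\pi)+1\big)\big(\lambda(\pi/2)+\lambda(3\pi/2)+1\big).$$ -/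

import Mathlib

open Filter Topology MeasureTheory

noncomputable section

namespace CA2D

/-- Configurations on the square lattice with alphabet `A`
(with the product topology and the product σ-algebra). -/
abbrev Config (A : Type*) := ℤ × ℤ → A

/-- The horizontal shift. -/
def shiftH {A : Type*} (x : Config A) : Config A := fun p => x (p.1 + 1, p.2)

/-- The vertical shift. -/
def shiftV {A : Type*} (x : Config A) : Config A := fun p => x (p.1, p.2 + 1)

/-- A two-dimensional cellular automaton: a continuous self-map commuting with both shifts. -/
structure IsCellularAutomaton {A : Type*} [TopologicalSpace A] (F : Config A → Config A) :
    Prop where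
  continuous : Continuous F
  comm_shiftH : ∀ x, F (shiftH x) = shiftH (F x)
  comm_shiftV : ∀ x, F (shiftV x) = shiftV (F x)

/-! ### Entropy

A finite partition of `X` is given by a labelling `P : X → ι` with `ι` finite; its cells are the
fibres of `P`. The join of finitely many partitions is the labelling by tuples. -/

/-- Shannon entropy `-∑ μ(C) log μ(C)` of the finite partition into the fibres of `P`. -/
def partitionEntropy {X ι : Type*} [MeasurableSpace X] [Fintype ι] (μ : Measure X) (P : X → ι) :
    ℝ :=
  ∑ i, Real.negMulLog (μ.real (P ⁻¹' {i}))

/-- Entropy of the transformation `T` with respect to the partition `P`: the limit of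
`(1/n) H(⋁_{0 ≤ k < n} T^{-k} P)`. -/
def entropyWrt {X ι : Type*} [MeasurableSpace X] [Fintype ι] (μ : Measure X) (T : X → X)
    (P : X → ι) : ℝ :=
  limUnder atTop fun n : ℕ =>
    partitionEntropy μ (fun (x : X) (k : Fin n) => P (T^[(k : ℕ)] x)) / (n : ℝ)

/-- Entropy of the `ℤ²`-shift action with respect to the partition `P`: the limit of
`(1/n²) H(⋁_{0 ≤ i, j < n} σ₁^{-i} σ₂^{-j} P)`. -/
def shiftEntropyWrt {A ι : Type*} [MeasurableSpace A] [Fintype ι] (μ : Measure (Config A))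
    (P : Config A → ι) : ℝ :=
  limUnder atTop fun n : ℕ =>
    partitionEntropy μ
      (fun (x : Config A) (k : Fin n × Fin n) =>
        P (shiftH^[(k.1 : ℕ)] (shiftV^[(k.2 : ℕ)] x))) / (n : ℝ) ^ 2

/-- Metric entropy of the `ℤ²`-shift action: the supremum over all finite measurable
partitions. -/
def shiftEntropy {A : Type*} [MeasurableSpace A] (μ : Measure (Config A)) : EReal :=
  ⨆ (m : ℕ) (P : Config A → Fin m) (_ : Measurable P), (shiftEntropyWrt μ P : EReal)

/-- The partition into cylinders fixing the `n × n` square `{0, …, n-1}²`. -/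
def squareBlock {A : Type*} (n : ℕ) (x : Config A) : Fin n × Fin n → A :=
  fun k => x (((k.1 : ℕ) : ℤ), ((k.2 : ℕ) : ℤ))

/-- The always finite entropy: the lower limit of the entropies of `F` with respect to the
partitions into `n × n` squares, divided by `n`. It is taken in the extended reals, so that its
finiteness is not presupposed. -/
def alwaysFiniteEntropy {A : Type*} [Fintype A] [MeasurableSpace A] (μ : Measure (Config A))
    (F : Config A → Config A) : EReal :=
  liminf (fun n : ℕ => ((entropyWrt μ F (squareBlock (A := A) n) / (n : ℝ) : ℝ) : EReal)) atTop

/-! ### Directional Lyapunov exponents -/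

/-- The almost line through `p`: integer parts of the points of the real line through `p`
that makes the angle `θ` with the vertical. -/
def almostLine (θ : ℝ) (p : ℤ × ℤ) : Set (ℤ × ℤ) :=
  {q | ∃ t : ℝ, q = (⌊(p.1 : ℝ) - t * Real.sin θ⌋, ⌊(p.2 : ℝ) + t * Real.cos θ⌋)}

/-- The lattice half plane delimited by the almost line through `p`, with outer normal
direction `(cos θ, sin θ)`. -/
def halfPlane (θ : ℝ) (p : ℤ × ℤ) : Set (ℤ × ℤ) :=
  {q | ((q.1 : ℝ) - p.1) * Real.cos θ + ((q.2 : ℝ) - p.2) * Real.sin θ ≤ 0} ∪ almostLine θ p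

/-- The set of all configurations that agree with `x` on the half plane. -/
def halfPlaneSet {A : Type*} (θ : ℝ) (p : ℤ × ℤ) (x : Config A) : Set (Config A) :=
  {y | ∀ q ∈ halfPlane θ p, y q = x q}

/-- The propagation of information at `x` during `n` iterations in direction `θ`: the least
distance to the origin of a point `p`, whose half plane contains the origin, such that
the values on the half plane at `p` determine those of the first `n` iterates on the half plane
at the origin. -/
def propagationAt {A : Type*} (F : Config A → Config A) (n : ℕ) (θ : ℝ) (x : Config A) : ℝ :=
  sInf {s : ℝ | ∃ p : ℤ × ℤ, s = Real.sqrt ((p.1 : ℝ) ^ 2 + (p.2 : ℝ) ^ 2) ∧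
    (0, 0) ∈ halfPlane θ p ∧
    ∀ k : ℕ, 1 ≤ k → k ≤ n →
      F^[k] '' halfPlaneSet θ p x ⊆ halfPlaneSet θ (0, 0) (F^[k] x)}

/-- The maximal propagation of information over all configurations. -/
def propagation {A : Type*} (F : Config A → Config A) (n : ℕ) (θ : ℝ) : ℝ :=
  ⨆ x : Config A, propagationAt F n θ x

/-- The Lyapunov exponent in direction `θ`. -/
def lyapunovExponent {A : Type*} (F : Config A → Config A) (θ : ℝ) : ℝ :=
  limUnder atTop fun n : ℕ => propagation F n θ / (n : ℝ)

end CA2D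

end

/-! Along a coordinate axis with unit vector `u`, the half planes are the sets of bounded `height
u`. There the propagation over `n` steps is the least width `N` such that the first `n` iterates at
the origin depend only on coordinates of height at most `N` (`exists_isLeast_propagation_eq`).
Dependence composes along iterates, so these widths are subadditive and Fekete's lemma gives the
exponents.

A function depending only on each of several coordinate sets depends only on their intersection.
With the four axis directions, the first `n` iterates on the `n × n` square are therefore determined
by a rectangle whose sides are asymptotically `αn` and `βn`, where `α` and `β` are the two factors
of the bound. Hence `h_μ(F, α_n) / n` is at most the entropy of that rectangle over `n²`
(`entropyWrt_squareBlock_div_le`).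

Covering the rectangle by `m × m` squares (`rectEntropy_le`) and letting `n → ∞` bounds the left
side by `αβ · H(m × m) / m²`. As `m → ∞` this tends to `αβ` times the shift entropy of the
one-coordinate partition, which is at most the supremum. -/

namespace CA2D

/-! ### Shannon entropy of finite partitions -/

section Entropy

variable {X ι κ : Type*} [MeasurableSpace X] [Fintype ι] [Fintype κ] {μ : Measure X}

theorem partitionEntropy_nonneg [IsProbabilityMeasure μ] (P : X → ι) :
    0 ≤ partitionEntropy μ P :=
  Finset.sum_nonneg fun _ _ => Real.negMulLog_nonneg measureReal_nonneg measureReal_le_one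

theorem partitionEntropy_comp_measurePreserving {T : X → X} (hT : MeasurePreserving T μ μ)
    {P : X → ι} (hP : ∀ i, MeasurableSet (P ⁻¹' {i})) :
    partitionEntropy μ (fun x => P (T x)) = partitionEntropy μ P := by
  refine Finset.sum_congr rfl fun i _ => ?_
  rw [← hT.measureReal_preimage (hP i).nullMeasurableSet]
  rfl

/-- Each term is at most the sum, so its logarithm is at most that of the sum. This is why merging
cells lowers entropy. -/
theorem negMulLog_sum_le {η : Type*} {s : Finset η} {f : η → ℝ} (hf : ∀ j ∈ s, 0 ≤ f j) :
    Real.negMulLog (∑ j ∈ s, f j) ≤ ∑ j ∈ s, Real.negMulLog (f j) := by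
  rw [Real.negMulLog, ← Finset.sum_neg_distrib, Finset.sum_mul]
  refine Finset.sum_le_sum fun j hj => ?_
  rw [Real.negMulLog, neg_mul, neg_mul, neg_le_neg_iff]
  rcases (hf j hj).eq_or_lt with h | h
  · simp [← h]
  · exact mul_le_mul_of_nonneg_left
      (Real.log_le_log h (Finset.single_le_sum (f := f) hf hj)) h.le

/-- A partition coarser than another one has smaller entropy. -/
theorem partitionEntropy_le_of_factorsThrough [IsProbabilityMeasure μ] {P : X → ι} {Q : X → κ}
    (hQ : ∀ j, MeasurableSet (Q ⁻¹' {j})) (h : Function.FactorsThrough P Q) :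
    partitionEntropy μ P ≤ partitionEntropy μ Q := by
  classical
  obtain ⟨x₀⟩ : Nonempty X := nonempty_of_isProbabilityMeasure μ
  have : Nonempty ι := ⟨P x₀⟩
  obtain ⟨g, rfl⟩ := (Function.factorsThrough_iff P).1 h
  unfold partitionEntropy
  rw [← Finset.sum_fiberwise Finset.univ g fun j => Real.negMulLog (μ.real (Q ⁻¹' {j}))]
  refine Finset.sum_le_sum fun i _ => ?_
  have : μ.real ((g ∘ Q) ⁻¹' {i}) = ∑ j with g j = i, μ.real (Q ⁻¹' {j}) := by
    rw [sum_measureReal_preimage_singleton _ fun j _ => hQ j]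
    congr 1
    ext x
    simp
  rw [this]
  exact negMulLog_sum_le fun _ _ => measureReal_nonneg

theorem partitionEntropy_congr [IsProbabilityMeasure μ] {P : X → ι} {Q : X → κ}
    (hP : ∀ i, MeasurableSet (P ⁻¹' {i})) (hQ : ∀ j, MeasurableSet (Q ⁻¹' {j}))
    (h : ∀ x y, P x = P y ↔ Q x = Q y) :
    partitionEntropy μ P = partitionEntropy μ Q :=
  (partitionEntropy_le_of_factorsThrough hQ fun x y hxy => (h x y).2 hxy).antisymm
    (partitionEntropy_le_of_factorsThrough hP fun x y hxy => (h x y).1 hxy)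

/-- Nonnegativity of the relative entropy of `r` with respect to the product of its marginals,
obtained from `log t ≤ t - 1` at `t = p q / r`. -/
theorem sum_negMulLog_le_of_marginals {r : ι × κ → ℝ} (hr : ∀ a, 0 ≤ r a)
    (hsum : ∑ a, r a = 1) {p : ι → ℝ} {q : κ → ℝ} (hp : ∀ i, ∑ j, r (i, j) = p i)
    (hq : ∀ j, ∑ i, r (i, j) = q j) :
    ∑ a, Real.negMulLog (r a) ≤ ∑ i, Real.negMulLog (p i) + ∑ j, Real.negMulLog (q j) := by
  have hple : ∀ i j, r (i, j) ≤ p i := fun i j => by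
    rw [← hp]
    exact Finset.single_le_sum (f := fun j => r (i, j)) (fun _ _ => hr _) (Finset.mem_univ j)
  have hqle : ∀ i j, r (i, j) ≤ q j := fun i j => by
    rw [← hq]
    exact Finset.single_le_sum (f := fun i => r (i, j)) (fun _ _ => hr _) (Finset.mem_univ i)
  have hp1 : ∑ i, p i = 1 := by
    rw [← hsum, Fintype.sum_prod_type]
    exact Finset.sum_congr rfl fun i _ => (hp i).symm
  have hq1 : ∑ j, q j = 1 := by
    rw [← hsum, Fintype.sum_prod_type_right]
    exact Finset.sum_congr rfl fun j _ => (hq j).symm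
  have hP : ∑ i, Real.negMulLog (p i) = ∑ a : ι × κ, -(r a * Real.log (p a.1)) := by
    rw [Fintype.sum_prod_type]
    refine Finset.sum_congr rfl fun i _ => ?_
    dsimp only
    rw [Finset.sum_neg_distrib, ← Finset.sum_mul, hp, Real.negMulLog, neg_mul]
  have hQ : ∑ j, Real.negMulLog (q j) = ∑ a : ι × κ, -(r a * Real.log (q a.2)) := by
    rw [Fintype.sum_prod_type_right]
    refine Finset.sum_congr rfl fun j _ => ?_
    dsimp only
    rw [Finset.sum_neg_distrib, ← Finset.sum_mul, hq, Real.negMulLog, neg_mul]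
  -- The correction `p q - r` sums to zero, since `p q` and `r` both have total mass one.
  have key : ∀ a : ι × κ, Real.negMulLog (r a) ≤
      -(r a * Real.log (p a.1)) + -(r a * Real.log (q a.2)) + (p a.1 * q a.2 - r a) := by
    rintro ⟨i, j⟩
    rcases (hr (i, j)).eq_or_lt with h | h
    · have h1 := (hr (i, j)).trans (hple i j)
      have h2 := (hr (i, j)).trans (hqle i j)
      simpa [← h] using mul_nonneg h1 h2
    · have h1 := h.trans_le (hple i j)
      have h2 := h.trans_le (hqle i j)
      have h3 := Real.log_le_sub_one_of_pos (div_pos (mul_pos h1 h2) h)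
      rw [Real.log_div (mul_pos h1 h2).ne' h.ne', Real.log_mul h1.ne' h2.ne'] at h3
      have h4 := mul_le_mul_of_nonneg_left h3 h.le
      have h5 : r (i, j) * (p i * q j / r (i, j) - 1) = p i * q j - r (i, j) := by
        field_simp
      rw [h5] at h4
      simp only [Real.negMulLog]
      linarith
  have hprod : ∑ a : ι × κ, p a.1 * q a.2 = 1 := by
    rw [Fintype.sum_prod_type, ← Finset.sum_mul_sum, hp1, hq1, one_mul]
  calc ∑ a, Real.negMulLog (r a)
      ≤ ∑ a : ι × κ, (-(r a * Real.log (p a.1)) + -(r a * Real.log (q a.2)) +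
          (p a.1 * q a.2 - r a)) := Finset.sum_le_sum fun a _ => key a
    _ = _ := by
      rw [Finset.sum_add_distrib, Finset.sum_add_distrib, Finset.sum_sub_distrib, hprod, hsum,
        hP, hQ]
      ring

/-- Subadditivity of entropy under joins. -/
theorem partitionEntropy_prod_le [IsProbabilityMeasure μ] {P : X → ι} {Q : X → κ}
    (hP : ∀ i, MeasurableSet (P ⁻¹' {i})) (hQ : ∀ j, MeasurableSet (Q ⁻¹' {j})) :
    partitionEntropy μ (fun x => (P x, Q x)) ≤ partitionEntropy μ P + partitionEntropy μ Q := by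
  classical
  have hPQ : ∀ a, MeasurableSet ((fun x => (P x, Q x)) ⁻¹' {a}) := fun a => by
    have : (fun x => (P x, Q x)) ⁻¹' {a} = P ⁻¹' {a.1} ∩ Q ⁻¹' {a.2} := by
      ext x
      simp [Prod.ext_iff]
    rw [this]
    exact (hP _).inter (hQ _)
  refine sum_negMulLog_le_of_marginals (fun _ => measureReal_nonneg) ?_ (fun i => ?_) fun j => ?_
  · rw [sum_measureReal_preimage_singleton _ fun a _ => hPQ a]
    simp
  · rw [← Finset.sum_image (f := fun a => μ.real ((fun x => (P x, Q x)) ⁻¹' {a}))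
        (g := fun j => (i, j)) (by intro; simp),
      sum_measureReal_preimage_singleton _ fun a _ => hPQ a]
    congr 1
    ext x
    simp [eq_comm]
  · rw [← Finset.sum_image (f := fun a => μ.real ((fun x => (P x, Q x)) ⁻¹' {a}))
        (g := fun i => (i, j)) (by intro; simp),
      sum_measureReal_preimage_singleton _ fun a _ => hPQ a]
    congr 1
    ext x
    simp [eq_comm]

theorem partitionEntropy_le_add [IsProbabilityMeasure μ] {ξ : Type*} [Fintype ξ] {R : X → ξ}
    {P : X → ι} {Q : X → κ}
    (hP : ∀ i, MeasurableSet (P ⁻¹' {i})) (hQ : ∀ j, MeasurableSet (Q ⁻¹' {j}))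
    (h : ∀ x y, P x = P y → Q x = Q y → R x = R y) :
    partitionEntropy μ R ≤ partitionEntropy μ P + partitionEntropy μ Q := by
  refine le_trans (partitionEntropy_le_of_factorsThrough (Q := fun x => (P x, Q x)) (fun a => ?_)
    fun x y hxy => ?_) (partitionEntropy_prod_le hP hQ)
  · have : (fun x => (P x, Q x)) ⁻¹' {a} = P ⁻¹' {a.1} ∩ Q ⁻¹' {a.2} := by
      ext x
      simp [Prod.ext_iff]
    rw [this]
    exact (hP _).inter (hQ _)
  · exact h x y (congrArg Prod.fst hxy) (congrArg Prod.snd hxy)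

theorem measurableSet_preimage_singleton_pi {β γ : Type*} [Finite β] {P : X → β → γ}
    (hP : ∀ b c, MeasurableSet ((fun x => P x b) ⁻¹' {c})) (f : β → γ) :
    MeasurableSet (P ⁻¹' {f}) := by
  have : P ⁻¹' {f} = ⋂ b, (fun x => P x b) ⁻¹' {f b} := by
    ext x
    simp [funext_iff]
  rw [this]
  exact MeasurableSet.iInter fun b => hP b _

/-- The joint entropies of the first `n` iterates form a subadditive sequence. -/
theorem subadditive_partitionEntropy_iterate [IsProbabilityMeasure μ] {T : X → X}
    (hT : MeasurePreserving T μ μ) {P : X → ι} (hP : ∀ i, MeasurableSet (P ⁻¹' {i})) :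
    Subadditive fun n : ℕ => partitionEntropy μ (fun (x : X) (k : Fin n) => P (T^[(k : ℕ)] x)) := by
  intro m n
  have hmeas : ∀ l f, MeasurableSet
      ((fun (x : X) (k : Fin l) => P (T^[(k : ℕ)] x)) ⁻¹' {f}) := fun l f =>
    measurableSet_preimage_singleton_pi (P := fun (x : X) (k : Fin l) => P (T^[(k : ℕ)] x))
      (fun b i => (hT.iterate (b : ℕ)).measurable (hP i)) f
  beta_reduce
  -- Iterates `m, …, m + n - 1` of `x` are the first `n` iterates of `T^[m] x`, and `T^[m]`
  -- preserves `μ`.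
  rw [← partitionEntropy_comp_measurePreserving (hT.iterate m) (hmeas n)]
  refine partitionEntropy_le_add (hmeas m) (fun f => (hT.iterate m).measurable (hmeas n f))
    fun x y h₁ h₂ => funext fun k => ?_
  rcases lt_or_ge (k : ℕ) m with hk | hk
  · exact congrFun h₁ ⟨k, hk⟩
  · have := congrFun h₂ ⟨k - m, by omega⟩
    simpa only [← Function.iterate_add_apply, Nat.sub_add_cancel hk] using this

theorem bddBelow_range_div_of_nonneg {u : ℕ → ℝ} (hu : ∀ n, 0 ≤ u n) :
    BddBelow (Set.range fun n : ℕ => u n / n) :=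
  ⟨0, by rintro _ ⟨n, rfl⟩; exact div_nonneg (hu n) n.cast_nonneg⟩

/-- By Fekete's lemma the limit is an infimum, so each single term bounds it from above. -/
theorem entropyWrt_le_div [IsProbabilityMeasure μ] {T : X → X}
    (hT : MeasurePreserving T μ μ) {P : X → ι} (hP : ∀ i, MeasurableSet (P ⁻¹' {i})) {n : ℕ}
    (hn : n ≠ 0) :
    entropyWrt μ T P ≤
      partitionEntropy μ (fun (x : X) (k : Fin n) => P (T^[(k : ℕ)] x)) / n := by
  have hsub := subadditive_partitionEntropy_iterate hT hP
  have hb := bddBelow_range_div_of_nonneg fun n : ℕ =>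
    partitionEntropy_nonneg (μ := μ) (fun (x : X) (k : Fin n) => P (T^[(k : ℕ)] x))
  rw [entropyWrt, (hsub.tendsto_lim hb).limUnder_eq]
  exact hsub.lim_le_div hb hn

end Entropy

end CA2D

namespace CA2D

/-! ### Translations -/

section Translation

variable {A : Type*}

/-- The shift by the lattice vector `v`. -/
def translate (v : ℤ × ℤ) (x : Config A) : Config A := fun q => x (q + v)

theorem translate_translate (v w : ℤ × ℤ) (x : Config A) :
    translate v (translate w x) = translate (v + w) x := by
  funext q
  simp only [translate, add_assoc]

theorem translate_zero (x : Config A) : translate 0 x = x := by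
  funext q
  simp only [translate, add_zero]

theorem shiftH_eq_translate : (shiftH : Config A → Config A) = translate (1, 0) := by
  funext x q
  simp [shiftH, translate, Prod.add_def]

theorem shiftV_eq_translate : (shiftV : Config A → Config A) = translate (0, 1) := by
  funext x q
  simp [shiftV, translate, Prod.add_def]

theorem iterate_translate (v : ℤ × ℤ) (n : ℕ) :
    (translate v : Config A → Config A)^[n] = translate (n • v) := by
  induction n with
  | zero => funext x; simp [translate_zero]
  | succ n ih =>
    funext x
    rw [Function.iterate_succ_apply', ih, translate_translate, succ_nsmul']

/-- The two basis vectors generate the lattice as a group. This passes invariance of `μ` and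
commutation with `F` from the two shifts to all translations. -/
theorem lattice_induction {p : ℤ × ℤ → Prop} (hH : p (1, 0)) (hV : p (0, 1))
    (hneg : ∀ v, p v → p (-v)) (hadd : ∀ v w, p v → p w → p (v + w)) (v : ℤ × ℤ) : p v := by
  have h0 : p 0 := add_neg_cancel ((1, 0) : ℤ × ℤ) ▸ hadd _ _ hH (hneg _ hH)
  have hmul : ∀ w, p w → ∀ n : ℤ, p (n • w) := fun w hw n => by
    have hnat : ∀ k : ℕ, p ((k : ℤ) • w) := fun k => by
      induction k with
      | zero => simpa using h0
      | succ k ih => simpa [add_smul] using hadd _ _ ih hw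
    obtain ⟨k, rfl | rfl⟩ := n.eq_nat_or_neg
    · exact hnat k
    · simpa using hneg _ (hnat k)
  have := hadd _ _ (hmul _ hH v.1) (hmul _ hV v.2)
  simpa using this

theorem measurePreserving_translate [MeasurableSpace A] {μ : Measure (Config A)}
    (hμH : MeasurePreserving shiftH μ μ) (hμV : MeasurePreserving shiftV μ μ) (v : ℤ × ℤ) :
    MeasurePreserving (translate v) μ μ := by
  have hmeas : ∀ v, Measurable (translate v : Config A → Config A) := fun v =>
    measurable_pi_lambda _ fun q => measurable_pi_apply _
  refine lattice_induction (p := fun v => MeasurePreserving (translate v) μ μ)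
    (shiftH_eq_translate (A := A) ▸ hμH) (shiftV_eq_translate (A := A) ▸ hμV)
    (fun v hv => ⟨hmeas _, ?_⟩) (fun v w hv hw => ?_) v
  · conv_lhs => rw [← hv.map_eq]
    rw [Measure.map_map (hmeas _) (hmeas _)]
    have : (translate (-v) : Config A → Config A) ∘ translate v = id := by
      funext x
      simp [translate_translate, translate_zero]
    rw [this, Measure.map_id]
  · have : (translate (v + w) : Config A → Config A) = translate v ∘ translate w := by
      funext x
      simp [translate_translate]
    rw [this]
    exact hv.comp hw

end Translation

/-! ### Dependence of the iterates on half planes -/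

section Dependence

/-- A function on a product that depends only on `s` and only on `t` depends only on `s ∩ t`. -/
theorem dependsOn_inter {ι β : Type*} {α : ι → Type*} {f : (∀ i, α i) → β} {s t : Set ι}
    (hs : DependsOn f s) (ht : DependsOn f t) : DependsOn f (s ∩ t) := by
  classical
  intro x y h
  -- The hybrid equals `x` on `s` and `y` off `s`; on `t` it agrees with `y` because `x = y` on `s ∩
  -- t`.
  trans f (s.piecewise x y)
  · exact hs fun i hi => by simp [hi]
  · refine ht fun i hi => ?_
    by_cases his : i ∈ s
    · simpa [his] using h i ⟨his, hi⟩
    · simp [his]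

/-- A continuous map from a product of finite discrete spaces to a discrete space depends on
finitely many coordinates. -/
theorem exists_finset_dependsOn {ι A B : Type*} [Finite A] [TopologicalSpace A]
    [DiscreteTopology A] [TopologicalSpace B] [DiscreteTopology B] {f : (ι → A) → B}
    (hf : Continuous f) : ∃ I : Finset ι, DependsOn f (I : Set ι) := by
  classical
  have hloc : ∀ x, ∃ I : Finset ι, ∀ y, (∀ i ∈ I, y i = x i) → f y = f x := fun x => by
    have ho : IsOpen (f ⁻¹' {f x}) := (isOpen_discrete _).preimage hf
    obtain ⟨I, u, hu, hIu⟩ := isOpen_pi_iff.1 ho x rfl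
    refine ⟨I, fun y hy => hIu fun i hi => ?_⟩
    rw [hy i hi]
    exact (hu i hi).2
  choose I hI using hloc
  have hopen : ∀ x, IsOpen ((I x : Set ι).pi fun i => ({x i} : Set A)) := fun x =>
    isOpen_set_pi (I x).finite_toSet fun i _ => isOpen_discrete _
  -- Finitely many cylinders on which `f` is constant cover the space; the union of their supports
  -- determines `f`.
  obtain ⟨t, ht⟩ := isCompact_univ.elim_finite_subcover _ hopen
    fun x _ => Set.mem_iUnion.2 ⟨x, fun i _ => rfl⟩
  refine ⟨t.biUnion I, fun y z hyz => ?_⟩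
  obtain ⟨x, hx, hyx⟩ : ∃ x ∈ t, ∀ i ∈ I x, y i = x i := by
    simpa using ht (Set.mem_univ y)
  rw [hI x y hyx, hI x z fun i hi => ?_]
  rw [← hyx i hi, hyz i (Finset.mem_coe.2 (Finset.mem_biUnion.2 ⟨x, hx, hi⟩))]

variable {A : Type*}

theorem IsCellularAutomaton.map_translate [TopologicalSpace A] {F : Config A → Config A}
    (hF : IsCellularAutomaton F) (v : ℤ × ℤ) (x : Config A) :
    F (translate v x) = translate v (F x) := by
  refine lattice_induction (p := fun v => ∀ x, F (translate v x) = translate v (F x))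
    (fun x => ?_) (fun x => ?_) (fun v hv x => ?_) (fun v w hv hw x => ?_) v x
  · simpa only [shiftH_eq_translate] using hF.comm_shiftH x
  · simpa only [shiftV_eq_translate] using hF.comm_shiftV x
  · have := hv (translate (-v) x)
    rw [translate_translate, add_neg_cancel, translate_zero] at this
    rw [this, translate_translate, neg_add_cancel, translate_zero]
  · rw [← translate_translate, hv, hw, translate_translate]

theorem IsCellularAutomaton.iterate_translate [TopologicalSpace A] {F : Config A → Config A}
    (hF : IsCellularAutomaton F) (k : ℕ) (v : ℤ × ℤ) (x : Config A) :
    F^[k] (translate v x) = translate v (F^[k] x) :=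
  Function.Semiconj.eq (Function.Commute.iterate_left (hF.map_translate v) k) x

/-- The height of the lattice point `q` in direction `u`. -/
def height (u q : ℤ × ℤ) : ℤ := u.1 * q.1 + u.2 * q.2

theorem height_add (u p q : ℤ × ℤ) : height u (p + q) = height u p + height u q := by
  simp only [height, Prod.fst_add, Prod.snd_add]
  ring

/-- The widths `m` such that the value at the origin of the first `n` iterates of `F` depends only
on the half plane of height at most `m` in direction `u`. -/
def determiningWidths (F : Config A → Config A) (u : ℤ × ℤ) (n : ℕ) : Set ℕ :=
  {m | ∀ k ≤ n, DependsOn (fun x : Config A => F^[k] x 0) {q | height u q ≤ m}}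

variable [TopologicalSpace A] {F : Config A → Config A}

theorem dependsOn_of_mem_determiningWidths (hF : IsCellularAutomaton F) {u : ℤ × ℤ} {n m k : ℕ}
    (hm : m ∈ determiningWidths F u n) (hk : k ≤ n) (q : ℤ × ℤ) :
    DependsOn (fun x : Config A => F^[k] x q) {p | height u p ≤ height u q + m} := by
  intro x y hxy
  have h := hm k hk (x := translate q x) (y := translate q y) fun p hp => hxy _ ?_
  · simpa only [hF.iterate_translate, translate, zero_add] using h
  · simp only [Set.mem_ofPred_eq, height_add] at hp ⊢
    omega

/-- For `k = j + n`, the value of `F^[j]` at the origin sees heights up to `m'` in `F^[n] x`, and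
each value there sees `m` further in `x`. -/
theorem add_mem_determiningWidths (hF : IsCellularAutomaton F) {u : ℤ × ℤ} {n n' m m' : ℕ}
    (hm : m ∈ determiningWidths F u n) (hm' : m' ∈ determiningWidths F u n') :
    m + m' ∈ determiningWidths F u (n + n') := by
  intro k hk
  rcases le_total k n with h | h
  · refine (hm k h).mono fun q (hq : height u q ≤ m) => ?_
    simp only [Set.mem_ofPred_eq, Nat.cast_add]
    omega
  · obtain ⟨j, rfl⟩ := Nat.exists_eq_add_of_le' h
    intro x y hxy
    simp only [Function.iterate_add_apply]
    refine hm' j (by omega) fun q hq => ?_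
    refine dependsOn_of_mem_determiningWidths hF hm le_rfl q fun p hp => hxy p ?_
    simp only [Set.mem_ofPred_eq, Nat.cast_add] at *
    omega

theorem nonempty_determiningWidths [Finite A] [DiscreteTopology A] (hF : IsCellularAutomaton F)
    (u : ℤ × ℤ) (n : ℕ) : (determiningWidths F u n).Nonempty := by
  induction n with
  | zero =>
    refine ⟨0, fun k hk x y hxy => ?_⟩
    obtain rfl : k = 0 := by omega
    exact hxy 0 (by simp [height])
  | succ n ih =>
    obtain ⟨m, hm⟩ := ih
    obtain ⟨I, hI⟩ := exists_finset_dependsOn ((continuous_apply (0 : ℤ × ℤ)).comp hF.continuous)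
    obtain ⟨r, hr⟩ : ∃ r : ℕ, ∀ q ∈ I, height u q ≤ r := by
      refine ⟨I.sup fun q => (height u q).toNat, fun q hq => (Int.self_le_toNat _).trans ?_⟩
      exact_mod_cast Finset.le_sup (f := fun q => (height u q).toNat) hq
    refine ⟨m + r, add_mem_determiningWidths hF hm fun k hk => ?_⟩
    obtain rfl | rfl : k = 0 ∨ k = 1 := by omega
    · exact fun x y hxy => hxy 0 (by simp [height])
    · exact hI.mono fun q hq => hr q hq

end Dependence

/-! ### Lyapunov exponents along the coordinate axes -/

section Lyapunov

variable {A : Type*} {F : Config A → Config A} {θ : ℝ} {u : ℤ × ℤ}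

theorem sq_add_sq_eq_one_of_cos_sin (hc : Real.cos θ = u.1) (hs : Real.sin θ = u.2) :
    u.1 ^ 2 + u.2 ^ 2 = 1 := by
  have := Real.cos_sq_add_sin_sq θ
  rw [hc, hs] at this
  exact_mod_cast this

/-- An integer unit vector lies on an axis, so the coordinate measured by `height u` is constant and
integral along the line. Taking integer parts leaves it unchanged, and the almost line adds nothing.
-/
theorem halfPlane_eq (hc : Real.cos θ = u.1) (hs : Real.sin θ = u.2) (p : ℤ × ℤ) :
    halfPlane θ p = {q | height u q ≤ height u p} := by
  have hu := sq_add_sq_eq_one_of_cos_sin hc hs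
  have hhalf : {q : ℤ × ℤ | ((q.1 : ℝ) - p.1) * Real.cos θ + ((q.2 : ℝ) - p.2) * Real.sin θ ≤ 0} =
      {q | height u q ≤ height u p} := by
    ext q
    simp only [Set.mem_ofPred_eq, height, hc, hs]
    norm_cast
    constructor <;> intro h <;> linarith
  rw [halfPlane, hhalf, Set.union_eq_left]
  rintro q ⟨t, rfl⟩
  simp only [Set.mem_ofPred_eq, height, hc, hs]
  have h0 : u.1 = 0 ∨ u.2 = 0 := by
    by_contra! h
    have h1 : 0 < u.1 ^ 2 := by have := h.1; positivity
    have h2 : 0 < u.2 ^ 2 := by have := h.2; positivity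
    omega
  rcases h0 with h | h <;> simp [h]

/-- Cauchy–Schwarz, from Lagrange's identity. -/
theorem height_le_sqrt (hu : u.1 ^ 2 + u.2 ^ 2 = 1) (p : ℤ × ℤ) :
    (height u p : ℝ) ≤ √((p.1 : ℝ) ^ 2 + (p.2 : ℝ) ^ 2) := by
  refine Real.le_sqrt_of_sq_le ?_
  have : height u p ^ 2 ≤ p.1 ^ 2 + p.2 ^ 2 := by
    have h : (u.1 ^ 2 + u.2 ^ 2) * (p.1 ^ 2 + p.2 ^ 2) =
      height u p ^ 2 + (u.1 * p.2 - u.2 * p.1) ^ 2 := by simp only [height]; ring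
    rw [hu, one_mul] at h
    rw [h]
    exact le_add_of_nonneg_right (sq_nonneg _)
  exact_mod_cast this

variable [TopologicalSpace A]

/-- The point `p = N u` is admissible at every `x` and has norm `N`. Conversely, failure of width `N
- 1` yields some `x` at which every admissible `p` has height, hence norm, at least `N`. -/
theorem exists_isLeast_propagation_eq [Finite A] [DiscreteTopology A] (hF : IsCellularAutomaton F)
    (hc : Real.cos θ = u.1) (hs : Real.sin θ = u.2) (n : ℕ) :
    ∃ N : ℕ, IsLeast (determiningWidths F u n) N ∧ propagation F n θ = N := by
  have hu := sq_add_sq_eq_one_of_cos_sin hc hs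
  have hne := nonempty_determiningWidths hF u n
  obtain ⟨N, hN⟩ : ∃ N, IsLeast (determiningWidths F u n) N :=
    ⟨_, Nat.sInf_mem hne, fun m hm => Nat.sInf_le hm⟩
  refine ⟨N, hN, ?_⟩
  have hmem : ∀ x : Config A, ∃ p : ℤ × ℤ, (N : ℝ) = √((p.1 : ℝ) ^ 2 + (p.2 : ℝ) ^ 2) ∧
      (0, 0) ∈ halfPlane θ p ∧ ∀ k : ℕ, 1 ≤ k → k ≤ n →
        F^[k] '' halfPlaneSet θ p x ⊆ halfPlaneSet θ (0, 0) (F^[k] x) := fun x => by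
    have hh : height u (N * u.1, N * u.2) = N := by
      have : height u (N * u.1, N * u.2) = N * (u.1 ^ 2 + u.2 ^ 2) := by
        simp only [height]; ring
      rw [this, hu, mul_one]
    refine ⟨(N * u.1, N * u.2), ?_, ?_, ?_⟩
    · have : ((N : ℤ) * u.1) ^ 2 + (N * u.2) ^ 2 = (N : ℤ) ^ 2 := by
        rw [mul_pow, mul_pow, ← mul_add, hu, mul_one]
      have h : (((N : ℤ) * u.1 : ℤ) : ℝ) ^ 2 + ((N * u.2 : ℤ) : ℝ) ^ 2 = (N : ℝ) ^ 2 := by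
        exact_mod_cast this
      rw [h, Real.sqrt_sq N.cast_nonneg]
    · rw [halfPlane_eq hc hs, Set.mem_ofPred_eq, hh]
      simp [height]
    · rintro k - hk _ ⟨y, hy, rfl⟩ q hq
      rw [halfPlane_eq hc hs] at hq
      refine dependsOn_of_mem_determiningWidths hF hN.1 hk q fun p hp => hy p ?_
      rw [halfPlane_eq hc hs, Set.mem_ofPred_eq, hh]
      have h0 : height u (0, 0) = 0 := by simp [height]
      simp only [Set.mem_ofPred_eq, h0] at hp hq
      omega
  have hbdd : ∀ x : Config A, BddBelow {s : ℝ | ∃ p : ℤ × ℤ,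
      s = √((p.1 : ℝ) ^ 2 + (p.2 : ℝ) ^ 2) ∧ (0, 0) ∈ halfPlane θ p ∧
      ∀ k : ℕ, 1 ≤ k → k ≤ n →
        F^[k] '' halfPlaneSet θ p x ⊆ halfPlaneSet θ (0, 0) (F^[k] x)} := fun x =>
    ⟨0, by rintro _ ⟨p, rfl, -⟩; exact Real.sqrt_nonneg _⟩
  have hle : ∀ x, propagationAt F n θ x ≤ N := fun x => csInf_le (hbdd x) (hmem x)
  have hnonneg : ∀ x, 0 ≤ propagationAt F n θ x := fun x =>
    Real.sInf_nonneg (by rintro _ ⟨p, rfl, -⟩; exact Real.sqrt_nonneg _)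
  refine (Real.iSup_le hle N.cast_nonneg).antisymm ?_
  -- For `N = 0` the truncated `N - 1` would be `N` itself, so minimality would say nothing.
  rcases N.eq_zero_or_pos with h0 | hpos
  · rw [h0, Nat.cast_zero]
    exact Real.iSup_nonneg hnonneg
  have hnot : N - 1 ∉ determiningWidths F u n := fun h => by
    have := hN.2 h
    omega
  simp only [determiningWidths, Set.mem_ofPred_eq, DependsOn, not_forall] at hnot
  obtain ⟨k, hk, x, y, hxy, hFxy⟩ := hnot
  refine le_ciSup_of_le ⟨N, by rintro _ ⟨x, rfl⟩; exact hle x⟩ x (le_csInf ⟨_, hmem x⟩ ?_)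
  rintro _ ⟨p, rfl, hp, hdet⟩
  -- Propagation only constrains `k ≥ 1`; for `k = 0` the origin already has height `0 ≤ N - 1`.
  have hk1 : 1 ≤ k := by
    by_contra! h
    obtain rfl : k = 0 := by omega
    exact hFxy (hxy 0 (by simp [height]))
  refine le_trans ?_ (height_le_sqrt hu p)
  by_contra! hlt
  have hlt' : height u p < N := by exact_mod_cast hlt
  refine hFxy (hdet k hk1 hk ⟨y, fun q hq => (hxy q ?_).symm, rfl⟩ 0 ?_).symm
  · rw [halfPlane_eq hc hs, Set.mem_ofPred_eq] at hq
    omega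
  · rw [halfPlane_eq hc hs]
    exact le_refl (height u 0)

theorem tendsto_propagation_div [Finite A] [DiscreteTopology A] (hF : IsCellularAutomaton F)
    (hc : Real.cos θ = u.1) (hs : Real.sin θ = u.2) :
    Tendsto (fun n : ℕ => propagation F n θ / (n : ℝ)) atTop (𝓝 (lyapunovExponent F θ)) := by
  choose N hN hprop using exists_isLeast_propagation_eq hF hc hs
  have hsub : Subadditive fun n => propagation F n θ := fun m n => by
    simp only [hprop]
    exact_mod_cast (hN (m + n)).2 (add_mem_determiningWidths hF (hN m).1 (hN n).1)
  refine tendsto_nhds_limUnder ⟨_, hsub.tendsto_lim (bddBelow_range_div_of_nonneg fun n => ?_)⟩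
  simp [hprop]

end Lyapunov

end CA2D

namespace CA2D

/-! ### Entropy of blocks of coordinates -/

section Block

theorem measurableSet_preimage_block {A β : Type*} [MeasurableSpace A]
    [MeasurableSingletonClass A] [Finite β] (c : β → ℤ × ℤ) (f : β → A) :
    MeasurableSet ((fun (x : Config A) (b : β) => x (c b)) ⁻¹' {f}) :=
  measurableSet_preimage_singleton_pi (P := fun (x : Config A) (b : β) => x (c b))
    (fun b i => measurable_pi_apply (c b) (measurableSet_singleton i)) f

variable {A : Type*} [Fintype A] [MeasurableSpace A] {μ : Measure (Config A)}

/-- Entropy of the partition according to the coordinates in the finite set `S`. -/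
noncomputable def blockEntropy (μ : Measure (Config A)) (S : Finset (ℤ × ℤ)) : ℝ :=
  partitionEntropy μ fun (x : Config A) (q : S) => x q

/-- Entropy of the partition according to the coordinates in a rectangle. -/
noncomputable def rectEntropy (μ : Measure (Config A)) (a b : ℕ) : ℝ :=
  blockEntropy μ (Finset.Ico (0 : ℤ) a ×ˢ Finset.Ico (0 : ℤ) b)

theorem rectEntropy_nonneg [IsProbabilityMeasure μ] (a b : ℕ) : 0 ≤ rectEntropy μ a b :=
  partitionEntropy_nonneg _

variable [MeasurableSingletonClass A]

/-- The supremum ranges over `Fin`-valued labellings, so the alphabet is renamed by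
`Fintype.equivFin`. -/
theorem shiftEntropyWrt_le_shiftEntropy :
    (shiftEntropyWrt μ (fun x : Config A => Fintype.equivFin A (x 0)) : EReal) ≤
      shiftEntropy μ :=
  le_iSup_of_le (Fintype.card A) <| le_iSup_of_le (fun x : Config A => Fintype.equivFin A (x 0)) <|
    le_iSup_of_le ((measurable_of_finite (Fintype.equivFin A)).comp (measurable_pi_apply 0)) le_rfl

variable [IsProbabilityMeasure μ]

theorem partitionEntropy_le_blockEntropy {ι : Type*} [Fintype ι] {P : Config A → ι}
    {S : Finset (ℤ × ℤ)} (h : DependsOn P (S : Set (ℤ × ℤ))) :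
    partitionEntropy μ P ≤ blockEntropy μ S :=
  partitionEntropy_le_of_factorsThrough
    (measurableSet_preimage_block fun q : S => (q : ℤ × ℤ))
    fun _ _ hxy => h fun q hq => congrFun hxy ⟨q, hq⟩

/-- Combines shift invariance with monotonicity under inclusion. -/
theorem blockEntropy_le_of_translate (hμ : ∀ v, MeasurePreserving (translate v) μ μ)
    {S T : Finset (ℤ × ℤ)} (v : ℤ × ℤ) (h : ∀ q ∈ T, q - v ∈ S) :
    blockEntropy μ T ≤ blockEntropy μ S := by
  have hS := measurableSet_preimage_block (A := A) fun q : S => (q : ℤ × ℤ)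
  unfold blockEntropy
  rw [← partitionEntropy_comp_measurePreserving (hμ v) hS]
  refine partitionEntropy_le_of_factorsThrough (fun f => (hμ v).measurable (hS f))
    fun x y hxy => funext fun q => ?_
  have := congrFun hxy ⟨q - v, h q q.2⟩
  simpa only [translate, sub_add_cancel] using this

theorem blockEntropy_union_le (S T : Finset (ℤ × ℤ)) :
    blockEntropy μ (S ∪ T) ≤ blockEntropy μ S + blockEntropy μ T := by
  refine partitionEntropy_le_add (measurableSet_preimage_block fun q : S => (q : ℤ × ℤ))
    (measurableSet_preimage_block fun q : T => (q : ℤ × ℤ)) fun x y hS hT => ?_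
  funext ⟨q, hq⟩
  rcases Finset.mem_union.1 hq with h | h
  · exact congrFun hS ⟨q, h⟩
  · exact congrFun hT ⟨q, h⟩

theorem rectEntropy_mono (hμ : ∀ v, MeasurePreserving (translate v) μ μ) {a b a' b' : ℕ}
    (ha : a ≤ a') (hb : b ≤ b') : rectEntropy μ a b ≤ rectEntropy μ a' b' := by
  refine blockEntropy_le_of_translate hμ 0 fun q hq => ?_
  simp only [Finset.mem_product, Finset.mem_Ico, sub_zero] at hq ⊢
  omega

theorem rectEntropy_add_left_le (hμ : ∀ v, MeasurePreserving (translate v) μ μ) (a a' b : ℕ) :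
    rectEntropy μ (a + a') b ≤ rectEntropy μ a b + rectEntropy μ a' b := by
  have hU : Finset.Ico (0 : ℤ) (a + a' : ℕ) ×ˢ Finset.Ico (0 : ℤ) b =
      Finset.Ico (0 : ℤ) a ×ˢ Finset.Ico (0 : ℤ) b ∪
        Finset.Ico (a : ℤ) (a + a' : ℕ) ×ˢ Finset.Ico (0 : ℤ) b := by
    rw [← Finset.union_product, Finset.Ico_union_Ico_eq_Ico] <;> omega
  rw [rectEntropy, hU]
  refine (blockEntropy_union_le _ _).trans (add_le_add le_rfl ?_)
  refine blockEntropy_le_of_translate hμ ((a : ℤ), 0) fun q hq => ?_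
  simp only [Finset.mem_product, Finset.mem_Ico, Prod.fst_sub, Prod.snd_sub] at hq ⊢
  omega

theorem rectEntropy_add_right_le (hμ : ∀ v, MeasurePreserving (translate v) μ μ) (a b b' : ℕ) :
    rectEntropy μ a (b + b') ≤ rectEntropy μ a b + rectEntropy μ a b' := by
  have hU : Finset.Ico (0 : ℤ) a ×ˢ Finset.Ico (0 : ℤ) (b + b' : ℕ) =
      Finset.Ico (0 : ℤ) a ×ˢ Finset.Ico (0 : ℤ) b ∪
        Finset.Ico (0 : ℤ) a ×ˢ Finset.Ico (b : ℤ) (b + b' : ℕ) := by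
    rw [← Finset.product_union, Finset.Ico_union_Ico_eq_Ico] <;> omega
  rw [rectEntropy, hU]
  refine (blockEntropy_union_le _ _).trans (add_le_add le_rfl ?_)
  refine blockEntropy_le_of_translate hμ (0, (b : ℤ)) fun q hq => ?_
  simp only [Finset.mem_product, Finset.mem_Ico, Prod.fst_sub, Prod.snd_sub] at hq ⊢
  omega

/-- Rounding `a` up to a multiple of `m` avoids a separate estimate for the remainder; at most `a /
m + 1` blocks of length `m` are needed. -/
theorem le_mul_of_subadditive_of_monotone {u : ℕ → ℝ} (hu : Subadditive u) (hmono : Monotone u)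
    {m : ℕ} (hm : m ≠ 0) (hnonneg : 0 ≤ u m) (a : ℕ) : u a ≤ (a + m) / m * u m := by
  have hk : ∀ k : ℕ, u ((k + 1) * m) ≤ (k + 1) * u m := fun k => by
    induction k with
    | zero => simp
    | succ k ih =>
      have := hu ((k + 1) * m) m
      rw [← Nat.succ_mul] at this
      push_cast
      linarith
  have hm' : (0 : ℝ) < m := by exact_mod_cast Nat.pos_of_ne_zero hm
  calc u a ≤ u ((a / m + 1) * m) := hmono (by
        have := Nat.lt_div_mul_add (a := a) (Nat.pos_of_ne_zero hm)
        rw [Nat.succ_mul]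
        omega)
    _ ≤ ((a / m : ℕ) + 1) * u m := hk _
    _ ≤ (a + m) / m * u m := by
        refine mul_le_mul_of_nonneg_right ?_ hnonneg
        rw [add_div, div_self hm'.ne']
        exact add_le_add Nat.cast_div_le le_rfl

theorem rectEntropy_le (hμ : ∀ v, MeasurePreserving (translate v) μ μ) {m : ℕ} (hm : m ≠ 0)
    (a b : ℕ) :
    rectEntropy μ a b ≤ (a + m) / m * ((b + m) / m * rectEntropy μ m m) := by
  refine (le_mul_of_subadditive_of_monotone (u := fun a => rectEntropy μ a b)
    (fun _ _ => rectEntropy_add_left_le hμ _ _ _) (fun _ _ h => rectEntropy_mono hμ h le_rfl) hm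
    (rectEntropy_nonneg _ _) a).trans (mul_le_mul_of_nonneg_left ?_ (by positivity))
  exact le_mul_of_subadditive_of_monotone (u := fun b => rectEntropy μ m b)
    (fun _ _ => rectEntropy_add_right_le hμ _ _ _) (fun _ _ h => rectEntropy_mono hμ le_rfl h) hm
    (rectEntropy_nonneg _ _) b

/-- For fixed `m`, the rounding excess `m` in each side vanishes after division by `n`. -/
theorem tendsto_rectEntropy_bound {a b : ℕ → ℕ} {α β : ℝ}
    (ha : Tendsto (fun n : ℕ => (a n : ℝ) / n) atTop (𝓝 α))
    (hb : Tendsto (fun n : ℕ => (b n : ℝ) / n) atTop (𝓝 β)) (m : ℕ) (c : ℝ) :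
    Tendsto (fun n : ℕ => ((a n : ℝ) + m) / m * (((b n : ℝ) + m) / m * c) / (n : ℝ) ^ 2) atTop
      (𝓝 (α * β * (c / (m : ℝ) ^ 2))) := by
  have hz : Tendsto (fun n : ℕ => (m : ℝ) / n) atTop (𝓝 0) :=
    tendsto_const_div_atTop_nhds_zero_nat _
  have h := ((ha.add hz).mul (hb.add hz)).mul_const (c / (m : ℝ) ^ 2)
  rw [add_zero, add_zero] at h
  refine h.congr fun n => ?_
  rw [← add_div, ← add_div, div_mul_div_comm, div_mul_eq_mul_div _ _ c, div_mul_div_comm,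
    div_mul_div_comm, div_div]
  congr 1 <;> ring

theorem exists_tendsto_rectEntropy_div (hμ : ∀ v, MeasurePreserving (translate v) μ μ) :
    ∃ L, Tendsto (fun n : ℕ => rectEntropy μ n n / (n : ℝ) ^ 2) atTop (𝓝 L) := by
  -- The limit is the infimum over `n ≥ 1`; the term at `n = 0` is a division by zero with value `0`
  -- and would spoil it.
  let S : Set ℝ := (fun n : ℕ => rectEntropy μ n n / (n : ℝ) ^ 2) '' Set.Ici 1
  have hS : BddBelow S := ⟨0, by
    rintro _ ⟨n, -, rfl⟩
    exact div_nonneg (rectEntropy_nonneg _ _) (sq_nonneg _)⟩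
  have hne : S.Nonempty := ⟨_, 1, Set.self_mem_Ici, rfl⟩
  refine ⟨sInf S, tendsto_order.2 ⟨fun l hl => ?_, fun l hl => ?_⟩⟩
  · filter_upwards [eventually_ge_atTop 1] with n hn
    exact hl.trans_le (csInf_le hS ⟨n, hn, rfl⟩)
  · obtain ⟨_, ⟨m, hm, rfl⟩, hml⟩ := exists_lt_of_csInf_lt hne hl
    have hm0 : m ≠ 0 := Nat.one_le_iff_ne_zero.1 hm
    have h1 : Tendsto (fun n : ℕ => (n : ℝ) / n) atTop (𝓝 1) := by
      refine tendsto_const_nhds.congr' ?_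
      filter_upwards [eventually_ne_atTop 0] with n hn
      rw [div_self (Nat.cast_ne_zero.2 hn)]
    have h := tendsto_rectEntropy_bound (a := id) (b := id) h1 h1 m (rectEntropy μ m m)
    rw [one_mul, one_mul] at h
    filter_upwards [h.eventually_lt_const hml] with n hn
    refine lt_of_le_of_lt ?_ hn
    gcongr
    exact rectEntropy_le hμ hm0 n n

theorem tendsto_rectEntropy_shiftEntropyWrt (hμ : ∀ v, MeasurePreserving (translate v) μ μ)
    {ι : Type*} [Fintype ι] {e : A → ι} (he : Function.Injective e) :
    Tendsto (fun n : ℕ => rectEntropy μ n n / (n : ℝ) ^ 2) atTop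
      (𝓝 (shiftEntropyWrt μ fun x : Config A => e (x 0))) := by
  have key : ∀ n : ℕ, rectEntropy μ n n = partitionEntropy μ
      (fun (x : Config A) (k : Fin n × Fin n) =>
        e (shiftH^[(k.1 : ℕ)] (shiftV^[(k.2 : ℕ)] x) 0)) := fun n => by
    have hval : ∀ (x : Config A) (k : Fin n × Fin n),
        shiftH^[(k.1 : ℕ)] (shiftV^[(k.2 : ℕ)] x) 0 = x ((k.1 : ℕ), (k.2 : ℕ)) := fun x k => by
      rw [shiftH_eq_translate, shiftV_eq_translate, iterate_translate, iterate_translate,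
        translate_translate]
      simp [translate]
    simp only [hval]
    refine partitionEntropy_congr (measurableSet_preimage_block fun q : ↥(_ : Finset (ℤ × ℤ)) =>
      (q : ℤ × ℤ)) (measurableSet_preimage_singleton_pi fun k i => ?_) fun x y =>
        ⟨fun h => funext fun k => congrArg e (congrFun h ⟨((k.1 : ℕ), (k.2 : ℕ)), ?_⟩), fun h => ?_⟩
    · have hi : MeasurableSet (e ⁻¹' {i}) := (Set.toFinite _).measurableSet
      exact (measurable_pi_apply (((k.1 : ℕ) : ℤ), ((k.2 : ℕ) : ℤ)) :
        Measurable fun x : Config A => x _) hi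
    · simp
    · funext ⟨⟨i, j⟩, hq⟩
      simp only [Finset.mem_product, Finset.mem_Ico] at hq
      have := he (congrFun h (⟨i.toNat, by omega⟩, ⟨j.toNat, by omega⟩))
      simpa only [Int.toNat_of_nonneg hq.1.1, Int.toNat_of_nonneg hq.2.1] using this
  unfold shiftEntropyWrt
  simp only [← key]
  exact tendsto_nhds_limUnder (exists_tendsto_rectEntropy_div hμ)

end Block

/-! ### The entropy of the automaton -/

section Automaton

variable {A : Type*} [Fintype A] [TopologicalSpace A] [MeasurableSpace A]
  [MeasurableSingletonClass A] {F : Config A → Config A} {μ : Measure (Config A)}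
  [IsProbabilityMeasure μ]

/-- The first `n` iterates on the `n × n` square depend only on the rectangle obtained by extending
the square on each side by the propagation in this direction. -/
theorem entropyWrt_squareBlock_div_le (hF : IsCellularAutomaton F)
    (hμ : ∀ v, MeasurePreserving (translate v) μ μ) (hμF : MeasurePreserving F μ μ) {n : ℕ}
    (hn : n ≠ 0) {r l t b : ℕ} (hr : r ∈ determiningWidths F (1, 0) n)
    (hl : l ∈ determiningWidths F (-1, 0) n) (ht : t ∈ determiningWidths F (0, 1) n)
    (hb : b ∈ determiningWidths F (0, -1) n) :
    entropyWrt μ F (squareBlock (A := A) n) / n ≤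
      rectEntropy μ (r + l + n) (t + b + n) / (n : ℝ) ^ 2 := by
  rw [sq, ← div_div]
  refine div_le_div_of_nonneg_right ((entropyWrt_le_div hμF
    (measurableSet_preimage_block _) hn).trans (div_le_div_of_nonneg_right ?_ n.cast_nonneg))
    n.cast_nonneg
  have hdep : DependsOn (fun (x : Config A) (k : Fin n) => squareBlock n (F^[(k : ℕ)] x))
      ((Finset.Ico (-l : ℤ) (n + r) ×ˢ Finset.Ico (-b : ℤ) (n + t) : Finset (ℤ × ℤ)) :
        Set (ℤ × ℤ)) := by
    intro x y hxy
    funext k c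
    have h := fun u m (hm : m ∈ determiningWidths F u n) =>
      dependsOn_of_mem_determiningWidths hF hm k.2.le (((c.1 : ℕ) : ℤ), ((c.2 : ℕ) : ℤ))
    -- The four half planes around the cell `c` meet in a rectangle, and `0 ≤ c.1, c.2 < n` places
    -- it in the enlarged square.
    refine dependsOn_inter (dependsOn_inter (h _ _ hr) (h _ _ hl))
      (dependsOn_inter (h _ _ ht) (h _ _ hb)) fun q hq => hxy q ?_
    simp only [Set.mem_inter_iff, Set.mem_ofPred_eq, height] at hq
    simp only [Finset.coe_product, Finset.coe_Ico, Set.mem_prod, Set.mem_Ico]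
    omega
  refine (partitionEntropy_le_blockEntropy hdep).trans
    -- This vector is the lower left corner, so the rectangle is moved to the origin.
    (blockEntropy_le_of_translate hμ (-(l : ℤ), -(b : ℤ)) fun q hq => ?_)
  simp only [Finset.mem_product, Finset.mem_Ico, Prod.fst_sub, Prod.snd_sub] at hq ⊢
  omega

/-- Two limits in order: `n → ∞` with the square size `m` fixed, then `m → ∞`. The angles enter only
through their cosines and sines. -/
theorem alwaysFiniteEntropy_le [DiscreteTopology A] (hF : IsCellularAutomaton F)
    (hμ : ∀ v, MeasurePreserving (translate v) μ μ) (hμF : MeasurePreserving F μ μ)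
    {θr θl θt θb : ℝ} (hrc : Real.cos θr = 1) (hrs : Real.sin θr = 0)
    (hlc : Real.cos θl = -1) (hls : Real.sin θl = 0)
    (htc : Real.cos θt = 0) (hts : Real.sin θt = 1)
    (hbc : Real.cos θb = 0) (hbs : Real.sin θb = -1) :
    alwaysFiniteEntropy μ F ≤ shiftEntropy μ *
      ((lyapunovExponent F θr + lyapunovExponent F θl + 1 : ℝ) : EReal) *
      ((lyapunovExponent F θt + lyapunovExponent F θb + 1 : ℝ) : EReal) := by
  have hsum : ∀ {θ θ' : ℝ} {N N' : ℕ → ℕ},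
      Tendsto (fun n : ℕ => propagation F n θ / (n : ℝ)) atTop (𝓝 (lyapunovExponent F θ)) →
      Tendsto (fun n : ℕ => propagation F n θ' / (n : ℝ)) atTop (𝓝 (lyapunovExponent F θ')) →
      (∀ n, propagation F n θ = N n) → (∀ n, propagation F n θ' = N' n) →
      Tendsto (fun n : ℕ => ((N n + N' n + n : ℕ) : ℝ) / n) atTop
        (𝓝 (lyapunovExponent F θ + lyapunovExponent F θ' + 1)) := by
    intro θ θ' N N' h h' hN hN'
    refine ((h.add h').add_const 1).congr' ?_
    filter_upwards [eventually_ne_atTop 0] with n hn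
    rw [hN, hN', ← add_div, div_add_one (Nat.cast_ne_zero.2 hn)]
    push_cast
    rfl
  have hrc' : Real.cos θr = ((1, 0) : ℤ × ℤ).1 := by simpa using hrc
  have hrs' : Real.sin θr = ((1, 0) : ℤ × ℤ).2 := by simpa using hrs
  have hlc' : Real.cos θl = ((-1, 0) : ℤ × ℤ).1 := by simpa using hlc
  have hls' : Real.sin θl = ((-1, 0) : ℤ × ℤ).2 := by simpa using hls
  have htc' : Real.cos θt = ((0, 1) : ℤ × ℤ).1 := by simpa using htc
  have hts' : Real.sin θt = ((0, 1) : ℤ × ℤ).2 := by simpa using hts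
  have hbc' : Real.cos θb = ((0, -1) : ℤ × ℤ).1 := by simpa using hbc
  have hbs' : Real.sin θb = ((0, -1) : ℤ × ℤ).2 := by simpa using hbs
  choose r hr hr' using exists_isLeast_propagation_eq hF hrc' hrs'
  choose l hl hl' using exists_isLeast_propagation_eq hF hlc' hls'
  choose t ht ht' using exists_isLeast_propagation_eq hF htc' hts'
  choose b hb hb' using exists_isLeast_propagation_eq hF hbc' hbs'
  have hα := hsum (tendsto_propagation_div hF hrc' hrs') (tendsto_propagation_div hF hlc' hls')
    hr' hl'
  have hβ := hsum (tendsto_propagation_div hF htc' hts') (tendsto_propagation_div hF hbc' hbs')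
    ht' hb'
  set α := lyapunovExponent F θr + lyapunovExponent F θl + 1
  set β := lyapunovExponent F θt + lyapunovExponent F θb + 1
  -- The signs are needed to multiply the last inequality by both factors in `EReal`.
  have hα0 : 0 ≤ α := ge_of_tendsto' hα fun n => by positivity
  have hβ0 : 0 ≤ β := ge_of_tendsto' hβ fun n => by positivity
  have hbound : ∀ m : ℕ, m ≠ 0 → alwaysFiniteEntropy μ F ≤
      ((α * β * (rectEntropy μ m m / (m : ℝ) ^ 2) : ℝ) : EReal) := fun m hm => by
    rw [← (EReal.tendsto_coe.2
      (tendsto_rectEntropy_bound hα hβ m (rectEntropy μ m m))).liminf_eq]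
    refine liminf_le_liminf ?_
    filter_upwards [eventually_ne_atTop 0] with n hn
    refine EReal.coe_le_coe_iff.2 ((entropyWrt_squareBlock_div_le hF hμ hμF hn (hr n).1 (hl n).1
      (ht n).1 (hb n).1).trans ?_)
    exact div_le_div_of_nonneg_right (rectEntropy_le hμ hm _ _) (sq_nonneg _)
  have hlim := tendsto_rectEntropy_shiftEntropyWrt hμ (Fintype.equivFin A).injective
  refine (ge_of_tendsto (EReal.tendsto_coe.2 (hlim.const_mul (α * β))) ?_).trans ?_
  · filter_upwards [eventually_ne_atTop 0] with m hm using hbound m hm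
  · rw [mul_comm, ← mul_assoc, EReal.coe_mul, EReal.coe_mul]
    gcongr
    exact shiftEntropyWrt_le_shiftEntropy

end Automaton

end CA2D

theorem proposition4 {A : Type*} [Fintype A] [TopologicalSpace A] [DiscreteTopology A]
    [MeasurableSpace A] [MeasurableSingletonClass A]
    (F : CA2D.Config A → CA2D.Config A) (hF : CA2D.IsCellularAutomaton F)
    (μ : Measure (CA2D.Config A)) [IsProbabilityMeasure μ]
    (hμH : MeasurePreserving CA2D.shiftH μ μ) (hμV : MeasurePreserving CA2D.shiftV μ μ)
    (hμF : MeasurePreserving F μ μ) :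
    (∀ θ ∈ ({0, Real.pi / 2, Real.pi, 3 * Real.pi / 2} : Set ℝ),
      Tendsto (fun n : ℕ => CA2D.propagation F n θ / (n : ℝ)) atTop
        (𝓝 (CA2D.lyapunovExponent F θ))) ∧
    CA2D.alwaysFiniteEntropy μ F ≤
      CA2D.shiftEntropy μ *
        ((CA2D.lyapunovExponent F 0 + CA2D.lyapunovExponent F Real.pi + 1 : ℝ) : EReal) *
        ((CA2D.lyapunovExponent F (Real.pi / 2) +
          CA2D.lyapunovExponent F (3 * Real.pi / 2) + 1 : ℝ) : EReal) := by
  have h3 : 3 * Real.pi / 2 = Real.pi / 2 + Real.pi := by ring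
  have hc3 : Real.cos (3 * Real.pi / 2) = 0 := by rw [h3, Real.cos_add_pi, Real.cos_pi_div_two,
    neg_zero]
  have hs3 : Real.sin (3 * Real.pi / 2) = -1 := by rw [h3, Real.sin_add_pi, Real.sin_pi_div_two]
  refine ⟨?_, CA2D.alwaysFiniteEntropy_le hF (CA2D.measurePreserving_translate hμH hμV) hμF
    Real.cos_zero Real.sin_zero Real.cos_pi Real.sin_pi Real.cos_pi_div_two Real.sin_pi_div_two
    hc3 hs3⟩
  rintro θ (rfl | rfl | rfl | rfl)
  · exact CA2D.tendsto_propagation_div (u := (1, 0)) hF (by simp) (by simp)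
  · exact CA2D.tendsto_propagation_div (u := (0, 1)) hF (by simp) (by simp)
  · exact CA2D.tendsto_propagation_div (u := (-1, 0)) hF (by simp) (by simp)
  · exact CA2D.tendsto_propagation_div (u := (0, -1)) hF (by simp [hc3]) (by simp [hs3])
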